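/- Let $H$ be a separable (real or complex) Hilbert space, and let $M$ be either $\mathbb{R}_+ = [0,\infty)$ or $\mathbb{R}_+^d$ for some $d \in \mathbb{N}$, with (coordinatewise) addition and the usual topology. A contractive $C_0$-semigroup over $H$ on $M$ is a map $T$ from $M$ to the bounded linear operators on $H$ such that $T(0) = I$, $T(s+t) = T(s)T(t)$ and $\|T(t)\| \le 1$ for all $s,t \in M$, and such that $t \mapsto T(t)\xi$ is continuous on $M$ for every $\xi \in H$. Equip the set of all these semigroups with the topology of uniform convergence in the weak operator topology on compact subsets of $M$, in which a net $(T_i)_i$ converges to $T$ if and only if $$\sup_{t \in K} |\langle (T_i(t) - T(t))\xi, \eta\rangle| \longrightarrow 0 \quad\text{for all } \xi,\eta \in H \text{ and all compact } K \subseteq M.$$ Then this space is Polish, that is, separable and completely metrizable. This holds both for one-parameter semigroups ($M = \mathbb{R}_+$) and for multiparameter semigroups ($M = \mathbb{R}_+^d$, for every $d \in \mathbb{N}$). -/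

import Mathlib

open scoped NNReal Topology UniformConvergence

/-- A contractive `C₀`-semigroup over the Hilbert space `H` on the topological monoid `(M, +, 0)`:
a map `T` from `M` to the bounded operators on `H` with `T 0 = I` and `T (s + t) = T s T t`, whose
values are contractions and which is continuous for the strong operator topology. -/
structure ContractiveC0Semigroup (𝕜 M H : Type*) [RCLike 𝕜] [AddMonoid M] [TopologicalSpace M]
    [NormedAddCommGroup H] [InnerProductSpace 𝕜 H] where
  toFun : M → H →L[𝕜] H
  map_zero : toFun 0 = ContinuousLinearMap.id 𝕜 H
  map_add : ∀ s t : M, toFun (s + t) = (toFun s).comp (toFun t)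
  contractive : ∀ t : M, ‖toFun t‖ ≤ 1
  strongly_continuous : ∀ ξ : H, Continuous fun t : M => toFun t ξ

namespace ContractiveC0Semigroup

variable {𝕜 M H : Type*} [RCLike 𝕜] [AddMonoid M] [TopologicalSpace M]
  [NormedAddCommGroup H] [InnerProductSpace 𝕜 H]

/-- The matrix coefficients `t ↦ ⟪T t ξ, η⟫` of `T`, for `ξ η : H`, as elements of the space of
functions `M → 𝕜` with the structure of uniform convergence on compact subsets of `M`. -/
def coeff (T : ContractiveC0Semigroup 𝕜 M H) (p : H × H) :
    M →ᵤ[{K : Set M | IsCompact K}] 𝕜 :=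
  UniformOnFun.ofFun {K : Set M | IsCompact K} fun t => inner 𝕜 (T.toFun t p.1) p.2

/-- The topology of uniform convergence on compact subsets of `M` for the weak operator
topology: the coarsest one for which every matrix coefficient depends continuously on `T`, when
functions on `M` carry the topology of uniform convergence on compact subsets. -/
instance instTopologicalSpace : TopologicalSpace (ContractiveC0Semigroup 𝕜 M H) :=
  TopologicalSpace.induced coeff inferInstance

/-- Convergence in this topology (of nets, or along arbitrary filters) means
`sup_{t ∈ K} |⟪(T i t - T t) ξ, η⟫| → 0` for all `ξ η : H` and all compact `K`. -/
theorem tendsto_iff {ι : Type*} {l : Filter ι} {F : ι → ContractiveC0Semigroup 𝕜 M H}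
    {T : ContractiveC0Semigroup 𝕜 M H} :
    Filter.Tendsto F l (𝓝 T) ↔ ∀ ξ η : H, ∀ K : Set M, IsCompact K →
      Filter.Tendsto (fun i => ⨆ t : K, ‖inner 𝕜 (((F i).toFun t - T.toFun t) ξ) η‖)
        l (𝓝 0) := by
  have hb : ∀ (S : ContractiveC0Semigroup 𝕜 M H) (ξ η : H) (K : Set M),
      BddAbove (Set.range fun t : K => ‖inner 𝕜 ((S.toFun t - T.toFun t) ξ) η‖) := by
    intro S ξ η K
    refine ⟨2 * ‖ξ‖ * ‖η‖, ?_⟩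
    rintro _ ⟨t, rfl⟩
    refine (norm_inner_le_norm _ _).trans ?_
    gcongr
    refine ((S.toFun t - T.toFun t).le_opNorm ξ).trans ?_
    gcongr
    have h1 := S.contractive t
    have h2 := T.contractive t
    exact (norm_sub_le _ _).trans (by linarith)
  rw [nhds_induced, Filter.tendsto_comap_iff, tendsto_pi_nhds, Prod.forall]
  refine forall_congr' fun ξ => forall_congr' fun η => ?_
  rw [UniformOnFun.tendsto_iff_tendstoUniformlyOn]
  refine forall_congr' fun K => forall_congr' fun _ => ?_
  have key : ∀ i, ∀ t : M, dist (inner 𝕜 (T.toFun t ξ) η) (inner 𝕜 ((F i).toFun t ξ) η)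
      = ‖inner 𝕜 (((F i).toFun t - T.toFun t) ξ) η‖ := by
    intro i t
    rw [dist_comm, dist_eq_norm, ← inner_sub_left, sub_apply]
  rw [Metric.tendstoUniformlyOn_iff, Metric.tendsto_nhds]
  constructor
  · intro h ε hε
    filter_upwards [h (ε / 2) (half_pos hε)] with i hi
    rw [Real.dist_0_eq_abs, abs_of_nonneg (Real.iSup_nonneg fun _ => norm_nonneg _)]
    refine lt_of_le_of_lt (Real.iSup_le (fun t => ?_) (half_pos hε).le) (half_lt_self hε)
    rw [← key i t]
    exact (hi t t.2).le
  · intro h ε hε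
    filter_upwards [h ε hε] with i hi t ht
    rw [Real.dist_0_eq_abs, abs_of_nonneg (Real.iSup_nonneg fun _ => norm_nonneg _)] at hi
    refine lt_of_le_of_lt ?_ hi
    exact (key i t).le.trans (le_ciSup (hb (F i) ξ η K) ⟨t, ht⟩)

end ContractiveC0Semigroup

/-! A semigroup is determined by its matrix coefficients, which embed the space into the families of
continuous functions on `M` that are sesquilinear, bounded by `‖ξ‖ * ‖η‖` and correct at `0`. These
families form a Polish space: they are closed in a complete product, and a dense sequence of vectors
controls them uniformly.

The law `T (s + t) = T s T t` is the difficulty, since multiplication is not jointly continuous for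
the weak operator topology. With a finite-rank projection `P` inserted, `⟪T s P T t ξ, η⟫` is a
finite sum of products of coefficients, hence continuous in the family. The law holds iff, for
arbitrarily large `P`, these sums approximate `⟪T (s + t) ξ, η⟫` uniformly on compact sets, which is
a `Gδ` condition (`isGδ_setOf_exists_defect_lt`, `range_coefficientFamily`). Strong continuity costs
nothing: for contractive semigroups it follows from weak continuity
(`continuous_orbit_of_continuous_inner`). -/

open Filter Set TopologicalSpace

/-! ### `Gδ` subspaces of Polish spaces -/

/-- A `Gδ` subset of a Polish space is Polish. -/
theorem IsGδ.polishSpace {X : Type*} [TopologicalSpace X] [PolishSpace X] {s : Set X}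
    (hs : IsGδ s) : PolishSpace s := by
  obtain ⟨U, hUo, hUc, rfl⟩ := hs
  have : Countable U := hUc.to_subtype
  have hU : ∀ u : U, PolishSpace (u : Set X) := fun u => (hUo u u.2).polishSpace
  -- The diagonal map: its range is closed, being cut out by equalities of coordinates. The factor
  -- `X` makes it an embedding even for empty `U`.
  let e : (⋂₀ U : Set X) → X × (∀ u : U, (u : Set X)) :=
    fun x => (x, fun u => ⟨x, mem_sInter.1 x.2 u u.2⟩)
  have he : Continuous e := by fun_prop
  have hemb : Topology.IsEmbedding e :=
    .of_comp he continuous_fst Topology.IsEmbedding.subtypeVal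
  have hrange : range e = {p | ∀ u : U, (p.2 u : X) = p.1} := by
    ext p
    constructor
    · rintro ⟨x, rfl⟩ u
      rfl
    · intro hp
      refine ⟨⟨p.1, mem_sInter.2 fun u hu => ?_⟩, ?_⟩
      · rw [← hp ⟨u, hu⟩]
        exact (p.2 ⟨u, hu⟩).2
      · exact Prod.ext rfl (funext fun u => Subtype.ext (hp u).symm)
  have hcl : IsClosed (range e) := by
    rw [hrange]
    simp only [ofPred_forall]
    exact isClosed_iInter fun u => isClosed_eq (by fun_prop) (by fun_prop)
  exact (Topology.IsClosedEmbedding.mk hemb hcl).polishSpace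

/-- A space embedded as a `Gδ` subset of a Polish space is Polish. -/
theorem Topology.IsEmbedding.polishSpace_of_isGδ_range {X Y : Type*} [TopologicalSpace X]
    [TopologicalSpace Y] [PolishSpace Y] {f : X → Y} (hf : IsEmbedding f) (h : IsGδ (range f)) :
    PolishSpace X :=
  have := h.polishSpace
  hf.toHomeomorph.isClosedEmbedding.polishSpace

/-! ### Hilbert space preliminaries -/

section Hilbert

variable {𝕜 H : Type*} [RCLike 𝕜] [NormedAddCommGroup H] [InnerProductSpace 𝕜 H]

theorem Orthonormal.countable [SeparableSpace H] {ι : Type*} {v : ι → H}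
    (hv : Orthonormal 𝕜 v) : Countable ι := by
  refine Pairwise.countable_of_isOpen_disjoint (s := fun i => Metric.ball (v i) (1 / 2)) ?_
    (fun i => Metric.isOpen_ball) (fun i => Metric.nonempty_ball.2 (by norm_num))
  intro i j hij
  refine Metric.ball_disjoint_ball ?_
  have h : ‖v i - v j‖ ^ 2 = 2 := by
    rw [@norm_sub_sq 𝕜, hv.1 i, hv.1 j, hv.2 hij]
    norm_num
  rw [dist_eq_norm]
  nlinarith [norm_nonneg (v i - v j)]

theorem Orthonormal.norm_sum_inner_smul_le {ι : Type*} {v : ι → H} (hv : Orthonormal 𝕜 v)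
    (s : Finset ι) (x : H) : ‖∑ i ∈ s, inner 𝕜 (v i) x • v i‖ ≤ ‖x‖ := by
  refine le_of_sq_le_sq ?_ (norm_nonneg x)
  refine le_trans (le_of_eq ?_) (hv.sum_inner_products_le (s := s) x)
  rw [@InnerProductSpace.norm_sq_eq_re_inner 𝕜, hv.inner_sum]
  simp only [map_sum, RCLike.conj_mul]
  norm_cast

/-- The finite partial sums of the expansion in a Hilbert basis converge uniformly on
compact sets. -/
theorem HilbertBasis.eventually_forall_norm_sum_sub_lt {ι : Type*} (b : HilbertBasis ι 𝕜 H)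
    {K : Set H} (hK : IsCompact K) {ε : ℝ} (hε : 0 < ε) :
    ∀ᶠ s : Finset ι in atTop, ∀ x ∈ K, ‖∑ i ∈ s, inner 𝕜 (b i) x • b i - x‖ < ε := by
  obtain ⟨t, -, htf, htK⟩ := hK.finite_cover_balls (e := ε / 3) (by positivity)
  have h1 : ∀ y ∈ t, ∀ᶠ s : Finset ι in atTop,
      ‖∑ i ∈ s, inner 𝕜 (b i) y • b i - y‖ < ε / 3 := by
    intro y _
    have h : HasSum (fun i => inner 𝕜 (b i) y • b i) y := by
      simpa only [b.repr_apply_apply] using b.hasSum_repr y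
    have h2 := (Metric.tendsto_nhds.1 h) (ε / 3) (by positivity)
    simpa only [dist_eq_norm, SummationFilter.unconditional_filter] using h2
  filter_upwards [(Set.Finite.eventually_all htf).2 h1] with s hs x hx
  obtain ⟨y, hy, hxy⟩ := mem_iUnion₂.1 (htK hx)
  rw [Metric.mem_ball, dist_eq_norm] at hxy
  -- Partial sums are contractions, so passing from `x` to a centre `y` of the finite net costs at
  -- most `2 * ‖x - y‖`, whatever `s` is.
  have h3 := b.orthonormal.norm_sum_inner_smul_le s (x - y)
  have h4 : ∑ i ∈ s, inner 𝕜 (b i) x • b i - x = ∑ i ∈ s, inner 𝕜 (b i) (x - y) • b i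
      + (∑ i ∈ s, inner 𝕜 (b i) y • b i - y) - (x - y) := by
    simp only [inner_sub_right, sub_smul, Finset.sum_sub_distrib]
    abel
  rw [h4]
  calc _ ≤ _ := norm_sub_le _ _
    _ ≤ _ := add_le_add_left (norm_add_le _ _) _
    _ < ε := by linarith [hs y hy]

/-- A sesquilinear form of norm at most one is represented by a contraction. -/
theorem exists_contraction_of_sesquilinear [CompleteSpace H] (B : H → H → 𝕜)
    (add_left : ∀ x y z, B (x + y) z = B x z + B y z)
    (smul_left : ∀ (c : 𝕜) x z, B (c • x) z = starRingEnd 𝕜 c * B x z)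
    (add_right : ∀ x y z, B x (y + z) = B x y + B x z)
    (smul_right : ∀ (c : 𝕜) x z, B x (c • z) = c * B x z)
    (bound : ∀ x y, ‖B x y‖ ≤ ‖x‖ * ‖y‖) :
    ∃ A : H →L[𝕜] H, ‖A‖ ≤ 1 ∧ ∀ x y, inner 𝕜 (A x) y = B x y := by
  let L : H →L⋆[𝕜] H →L[𝕜] 𝕜 :=
    (LinearMap.mk₂'ₛₗ (starRingEnd 𝕜) (RingHom.id 𝕜) B add_left smul_left add_right
      smul_right).mkContinuous₂ 1 (by simpa using bound)
  have hA : ∀ x y, inner 𝕜 (InnerProductSpace.continuousLinearMapOfBilin L x) y = B x y :=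
    fun x y => InnerProductSpace.continuousLinearMapOfBilin_apply L x y
  refine ⟨InnerProductSpace.continuousLinearMapOfBilin L, ?_, hA⟩
  refine ContinuousLinearMap.opNorm_le_bound _ zero_le_one fun x => ?_
  set y := InnerProductSpace.continuousLinearMapOfBilin L x with hy
  have h1 : ‖y‖ * ‖y‖ ≤ ‖x‖ * ‖y‖ := by
    rw [← inner_self_eq_norm_mul_norm (𝕜 := 𝕜) y]
    refine (RCLike.re_le_norm _).trans ?_
    conv_lhs => rw [hy, hA]
    exact bound _ _
  rw [one_mul]
  rcases (norm_nonneg y).eq_or_lt with h0 | h0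
  · exact h0 ▸ norm_nonneg x
  · exact le_of_mul_le_mul_right h1 h0

end Hilbert

/-! ### The Polish space of coefficient families -/

section CoefficientFamilies

variable {𝕜 M H : Type*} [RCLike 𝕜] [Zero M] [TopologicalSpace M]
  [NormedAddCommGroup H] [InnerProductSpace 𝕜 H]

/-- The families `F (ξ, η)` of scalar functions on `M` that are the matrix coefficients of a
contraction-valued function, continuous for the weak operator topology, with value `I` at `0`. -/
structure IsCoefficientFamily (F : H × H → C(M, 𝕜)) : Prop where
  add_left : ∀ x y z t, F (x + y, z) t = F (x, z) t + F (y, z) t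
  smul_left : ∀ (c : 𝕜) x z t, F (c • x, z) t = starRingEnd 𝕜 c * F (x, z) t
  add_right : ∀ x y z t, F (x, y + z) t = F (x, y) t + F (x, z) t
  smul_right : ∀ (c : 𝕜) x z t, F (x, c • z) t = c * F (x, z) t
  bound : ∀ x y t, ‖F (x, y) t‖ ≤ ‖x‖ * ‖y‖
  map_zero : ∀ x y, F (x, y) 0 = inner 𝕜 x y

variable (𝕜 M H) in
/-- The space of coefficient families, with pointwise convergence in `ξ`, `η` and uniform
convergence on compact subsets of `M`. -/
abbrev CoefficientFamily : Type _ := {F : H × H → C(M, 𝕜) // IsCoefficientFamily F}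

theorem isClosed_setOf_isCoefficientFamily :
    IsClosed {F : H × H → C(M, 𝕜) | IsCoefficientFamily F} := by
  have heval : ∀ (p : H × H) (t : M), Continuous fun F : H × H → C(M, 𝕜) => F p t :=
    fun p t => (continuous_eval_const t).comp (continuous_apply p)
  have : {F : H × H → C(M, 𝕜) | IsCoefficientFamily F} =
      {F | ∀ x y z t, F (x + y, z) t = F (x, z) t + F (y, z) t} ∩
      {F | ∀ (c : 𝕜) x z t, F (c • x, z) t = starRingEnd 𝕜 c * F (x, z) t} ∩
      {F | ∀ x y z t, F (x, y + z) t = F (x, y) t + F (x, z) t} ∩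
      {F | ∀ (c : 𝕜) x z t, F (x, c • z) t = c * F (x, z) t} ∩
      {F | ∀ x y t, ‖F (x, y) t‖ ≤ ‖x‖ * ‖y‖} ∩
      {F | ∀ x y, F (x, y) 0 = inner 𝕜 x y} := by
    ext F
    exact ⟨fun h => ⟨⟨⟨⟨⟨h.1, h.2⟩, h.3⟩, h.4⟩, h.5⟩, h.6⟩,
      fun ⟨⟨⟨⟨⟨h1, h2⟩, h3⟩, h4⟩, h5⟩, h6⟩ => ⟨h1, h2, h3, h4, h5, h6⟩⟩
  rw [this]
  simp only [ofPred_forall]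
  refine ((((IsClosed.inter ?_ ?_).inter ?_).inter ?_).inter ?_).inter ?_ <;>
    repeat refine isClosed_iInter fun _ => ?_
  · exact isClosed_eq (heval _ _) ((heval _ _).add (heval _ _))
  · exact isClosed_eq (heval _ _) ((heval _ _).const_mul _)
  · exact isClosed_eq (heval _ _) ((heval _ _).add (heval _ _))
  · exact isClosed_eq (heval _ _) ((heval _ _).const_mul _)
  · exact isClosed_le (heval _ _).norm continuous_const
  · exact isClosed_eq (heval _ _) continuous_const

namespace IsCoefficientFamily

theorem sub_left {F : H × H → C(M, 𝕜)} (hF : IsCoefficientFamily F) (x y z : H) (t : M) :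
    F (x - y, z) t = F (x, z) t - F (y, z) t := by
  rw [eq_sub_iff_add_eq, ← hF.add_left, sub_add_cancel]

theorem sub_right {F : H × H → C(M, 𝕜)} (hF : IsCoefficientFamily F) (x y z : H) (t : M) :
    F (x, y - z) t = F (x, y) t - F (x, z) t := by
  rw [eq_sub_iff_add_eq, ← hF.add_right, sub_add_cancel]

theorem dist_le {F : H × H → C(M, 𝕜)} (hF : IsCoefficientFamily F) (x x' y y' : H) (t : M) :
    dist (F (x, y) t) (F (x', y') t) ≤ ‖x - x'‖ * ‖y‖ + ‖x'‖ * ‖y - y'‖ := by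
  have h : F (x, y) t - F (x', y') t = F (x - x', y) t + F (x', y - y') t := by
    rw [hF.sub_left, hF.sub_right]
    ring
  rw [dist_eq_norm, h]
  exact (norm_add_le _ _).trans (add_le_add (hF.bound _ _ _) (hF.bound _ _ _))

end IsCoefficientFamily

namespace CoefficientFamily

/-- Restriction of a coefficient family to pairs of vectors from a sequence. -/
def restrict (u : ℕ → H) (F : CoefficientFamily 𝕜 M H) : ℕ × ℕ → C(M, 𝕜) :=
  fun n => F.1 (u n.1, u n.2)

/-- The estimate `dist_le` depends on neither `F` nor `t`, so each coefficient is approximated,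
uniformly over all families, by one with vectors from the sequence. This reduces an arbitrary
product to a countable one. -/
theorem isUniformInducing_restrict {u : ℕ → H} (hu : DenseRange u) :
    IsUniformInducing (restrict u : CoefficientFamily 𝕜 M H → ℕ × ℕ → C(M, 𝕜)) := by
  have hcoord : ∀ n m : ℕ, UniformContinuous
      fun F : CoefficientFamily 𝕜 M H => F.1 (u n, u m) := fun n m =>
    (Pi.uniformContinuous_proj _ _).comp uniformContinuous_subtype_val
  refine ⟨le_antisymm ?_ ?_⟩
  · have huniv : uniformity (CoefficientFamily 𝕜 M H) = ⨅ p : H × H,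
        comap (fun q => (q.1.1 p, q.2.1 p)) (uniformity C(M, 𝕜)) := by
      rw [uniformity_subtype, Pi.uniformity, Filter.comap_iInf]
      simp only [comap_comap, Function.comp_def]
    rw [huniv]
    refine le_iInf fun p => ?_
    rw [← tendsto_iff_comap,
      (Metric.uniformity_basis_dist.compactConvergenceUniformity (α := M)).tendsto_right_iff]
    rintro ⟨K, ε⟩ ⟨hK, hε⟩
    -- This is the bound of `dist_le` for vectors within `δ` of `p.1` and `p.2`.
    obtain ⟨δ, hδ, hδε⟩ : ∃ δ > 0, δ * ‖p.2‖ + (‖p.1‖ + δ) * δ < ε / 3 := by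
      have hc : Continuous fun δ : ℝ => δ * ‖p.2‖ + (‖p.1‖ + δ) * δ := by fun_prop
      have hev := hc.tendsto 0 |>.eventually_lt_const (u := ε / 3)
        (by simpa using hε)
      obtain ⟨δ, h1, h2⟩ :=
        ((hev.filter_mono nhdsWithin_le_nhds).and (self_mem_nhdsWithin (s := Ioi 0))).exists
      exact ⟨δ, h2, h1⟩
    obtain ⟨n, hn⟩ := hu.exists_dist_lt p.1 hδ
    obtain ⟨m, hm⟩ := hu.exists_dist_lt p.2 hδ
    have happrox : ∀ (F : CoefficientFamily 𝕜 M H) t,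
        dist (F.1 p t) (F.1 (u n, u m) t) < ε / 3 := by
      intro F t
      rw [dist_eq_norm] at hn hm
      refine (F.2.dist_le p.1 (u n) p.2 (u m) t).trans_lt (lt_of_le_of_lt ?_ hδε)
      have h3 : ‖u n‖ ≤ ‖p.1‖ + δ := by
        have := norm_sub_norm_le (u n) p.1
        rw [norm_sub_rev] at this
        linarith
      gcongr
    have hmem : {fg : C(M, 𝕜) × C(M, 𝕜) | ∀ x ∈ K, (fg.1 x, fg.2 x) ∈
        {q : 𝕜 × 𝕜 | dist q.1 q.2 < ε / 3}} ∈ uniformity C(M, 𝕜) :=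
      (Metric.uniformity_basis_dist.compactConvergenceUniformity (α := M)).mem_of_mem
        (i := (K, ε / 3)) ⟨hK, by positivity⟩
    refine mem_of_superset (preimage_mem_comap
      (Pi.uniformContinuous_proj (fun _ : ℕ × ℕ => C(M, 𝕜)) (n, m) hmem)) ?_
    rintro ⟨F, G⟩ hFG t ht
    have h1 := happrox F t
    have h2 := happrox G t
    have h3 : dist (F.1 (u n, u m) t) (G.1 (u n, u m) t) < ε / 3 := hFG t ht
    rw [dist_comm] at h2
    change dist (F.1 p t) (G.1 p t) < ε
    linarith [dist_triangle4 (F.1 p t) (F.1 (u n, u m) t) (G.1 (u n, u m) t) (G.1 p t)]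
  · rw [← tendsto_iff_comap]
    exact uniformContinuous_pi.2 fun n => hcoord n.1 n.2

instance polishSpace [LocallyCompactSpace M] [SecondCountableTopology M] [SeparableSpace H] :
    PolishSpace (CoefficientFamily 𝕜 M H) := by
  have hR := isUniformInducing_restrict (𝕜 := 𝕜) (M := M) (denseRange_denseSeq H)
  have : (uniformity (CoefficientFamily 𝕜 M H)).IsCountablyGenerated := by
    rw [← hR.comap_uniformity]
    infer_instance
  have : SecondCountableTopology (CoefficientFamily 𝕜 M H) :=
    hR.isInducing.secondCountableTopology
  have : CompleteSpace (CoefficientFamily 𝕜 M H) :=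
    isClosed_setOf_isCoefficientFamily.completeSpace_coe
  have : MetrizableSpace (CoefficientFamily 𝕜 M H) := UniformSpace.metrizableSpace
  infer_instance

/-- The contraction with the matrix coefficients `F (ξ, η) t`. -/
theorem exists_operator [CompleteSpace H] (F : CoefficientFamily 𝕜 M H) (t : M) :
    ∃ A : H →L[𝕜] H, ‖A‖ ≤ 1 ∧ ∀ x y, inner 𝕜 (A x) y = F.1 (x, y) t :=
  exists_contraction_of_sesquilinear (fun x y => F.1 (x, y) t)
    (fun x y z => F.2.add_left x y z t) (fun c x z => F.2.smul_left c x z t)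
    (fun x y z => F.2.add_right x y z t) (fun c x z => F.2.smul_right c x z t)
    (fun x y => F.2.bound x y t)

end CoefficientFamily

end CoefficientFamilies

/-! ### From weak to strong continuity -/

section WeakToStrong

variable {𝕜 M H : Type*} [RCLike 𝕜] [AddMonoid M] [TopologicalSpace M]
  [NormedAddCommGroup H] [InnerProductSpace 𝕜 H]

/-- A truncated difference on a topological additive monoid: `d` is continuous, vanishes on the
diagonal, and any two elements `t`, `u` have a common lower bound `m` with differences `d t u`
and `d u t`. -/
structure IsTruncatedDifference (d : M → M → M) : Prop where
  continuous : Continuous fun p : M × M => d p.1 p.2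
  self : ∀ t, d t t = 0
  exists_add : ∀ t u, ∃ m, m + d t u = t ∧ m + d u t = u

/-- A contractive semigroup that is continuous for the weak operator topology is continuous for
the strong operator topology. -/
theorem continuous_orbit_of_continuous_inner {d : M → M → M} (hd : IsTruncatedDifference d)
    {T : M → H →L[𝕜] H} (map_zero : T 0 = ContinuousLinearMap.id 𝕜 H)
    (map_add : ∀ s t, T (s + t) = (T s).comp (T t)) (contractive : ∀ t, ‖T t‖ ≤ 1) {ξ : H}
    (hT : Continuous fun t => inner 𝕜 (T t ξ) ξ) : Continuous fun t => T t ξ := by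
  have hle : ∀ t x, ‖T t x‖ ≤ ‖x‖ := fun t x => by
    simpa using (T t).le_of_opNorm_le (contractive t) x
  -- Expanding `‖T t ξ - ξ‖ ^ 2` and using `‖T t ξ‖ ≤ ‖ξ‖` gives the weakly continuous bound `g t`.
  set g : M → ℝ := fun t => √(2 * ‖ξ‖ ^ 2 - 2 * RCLike.re (inner 𝕜 (T t ξ) ξ)) with hg
  have hgc : Continuous g := by
    have := RCLike.continuous_re.comp hT
    exact (continuous_const.sub (continuous_const.mul this)).sqrt
  have hg0 : g 0 = 0 := by
    simp [hg, map_zero]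
  have hgle : ∀ t, ‖T t ξ - ξ‖ ≤ g t := by
    intro t
    refine Real.le_sqrt_of_sq_le ?_
    rw [@norm_sub_sq 𝕜]
    have := pow_le_pow_left₀ (norm_nonneg _) (hle t ξ) 2
    linarith
  have hdiff : ∀ m s, ‖T (m + s) ξ - T m ξ‖ ≤ g s := by
    intro m s
    rw [map_add, ContinuousLinearMap.comp_apply, ← map_sub]
    exact (hle _ _).trans (hgle s)
  rw [continuous_iff_continuousAt]
  intro t
  have hlim : Tendsto (fun u => g (d u t) + g (d t u)) (𝓝 t) (𝓝 0) := by
    have hc : Continuous fun u => g (d u t) + g (d t u) :=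
      (hgc.comp (hd.continuous.comp (continuous_id.prodMk continuous_const))).add
        (hgc.comp (hd.continuous.comp (continuous_const.prodMk continuous_id)))
    simpa [hd.self, hg0] using hc.tendsto t
  rw [ContinuousAt, tendsto_iff_norm_sub_tendsto_zero]
  refine squeeze_zero (fun _ => norm_nonneg _) (fun u => ?_) hlim
  -- Both orbit points are compared with `T m ξ`. No continuity of `m` is needed, as `T m` is a
  -- contraction.
  obtain ⟨m, hm1, hm2⟩ := hd.exists_add t u
  have h1 := hdiff m (d t u)
  have h2 := hdiff m (d u t)
  rw [hm1] at h1
  rw [hm2] at h2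
  have h3 := norm_sub_le (T u ξ - T m ξ) (T t ξ - T m ξ)
  rw [sub_sub_sub_cancel_right] at h3
  linarith

end WeakToStrong

/-! ### The semigroup law as a `Gδ` condition -/

namespace CoefficientFamily

variable {𝕜 M H : Type*} [RCLike 𝕜] [AddMonoid M] [TopologicalSpace M] [ContinuousAdd M]
  [NormedAddCommGroup H] [InnerProductSpace 𝕜 H]

/-- The function `(s, t) ↦ ⟪T s (P (T t x)), y⟫ - ⟪T (s + t) x, y⟫`, where `P` is the projection
onto the span of the vectors `v i` with `i ∈ a`, written in terms of matrix coefficients. -/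
def defect {ι : Type*} (v : ι → H) (x y : H) (a : Finset ι) (F : CoefficientFamily 𝕜 M H) :
    C(M × M, 𝕜) :=
  ∑ i ∈ a, (F.1 (x, v i)).comp ⟨Prod.snd, continuous_snd⟩ *
    (F.1 (v i, y)).comp ⟨Prod.fst, continuous_fst⟩
    - (F.1 (x, y)).comp ⟨fun p => p.1 + p.2, continuous_add⟩

theorem continuous_defect [LocallyCompactSpace M] {ι : Type*} (v : ι → H) (x y : H) (a : Finset ι) :
    Continuous (defect v x y a : CoefficientFamily 𝕜 M H → C(M × M, 𝕜)) := by
  have h : ∀ (p : H × H) (φ : C(M × M, M)), Continuous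
      fun F : CoefficientFamily 𝕜 M H => (F.1 p).comp φ := fun p φ =>
    (ContinuousMap.continuous_precomp φ).comp ((continuous_apply p).comp continuous_subtype_val)
  exact (continuous_finsetSum _ fun i _ => (h _ _).mul (h _ _)).sub (h _ _)

theorem defect_apply {ι : Type*} (v : ι → H) (x y : H) (a : Finset ι)
    (F : CoefficientFamily 𝕜 M H) {T : M → H →L[𝕜] H}
    (hT : ∀ t x y, inner 𝕜 (T t x) y = F.1 (x, y) t) (p : M × M) :
    defect v x y a F p =
      inner 𝕜 (T p.1 (∑ i ∈ a, inner 𝕜 (v i) (T p.2 x) • v i) - T (p.1 + p.2) x) y := by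
  simp [defect, ← hT, inner_sub_left, sum_inner, inner_smul_left]

/-- The coefficient families with asymptotically vanishing defect form a `Gδ` set. -/
theorem isGδ_setOf_exists_defect_lt {ι : Type*} [Countable ι] [LocallyCompactSpace M]
    [SigmaCompactSpace M] (v : ι → H)
    (u : ℕ → H) : IsGδ {F : CoefficientFamily 𝕜 M H | ∀ (m n k j : ℕ) (a : Finset ι),
      ∃ a' ≥ a, MapsTo (defect v (u m) (u n) a' F)
        (compactCovering M j ×ˢ compactCovering M j) (Metric.ball 0 (1 / (k + 1)))} := by
  simp only [ofPred_forall, ofPred_exists]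
  refine .iInter fun m => .iInter fun n => .iInter fun k => .iInter fun j => .iInter fun a =>
    IsOpen.isGδ (isOpen_iUnion fun a' => ?_)
  by_cases h : a' ≥ a
  · simp only [h, true_and]
    exact (ContinuousMap.isOpen_setOfPred_mapsTo
      ((isCompact_compactCovering M j).prod (isCompact_compactCovering M j))
      Metric.isOpen_ball).preimage (continuous_defect v (u m) (u n) a')
  · simp [h]

end CoefficientFamily

/-! ### Semigroups among the coefficient families -/

namespace ContractiveC0Semigroup

variable {𝕜 M H : Type*} [RCLike 𝕜] [AddMonoid M] [TopologicalSpace M]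
  [NormedAddCommGroup H] [InnerProductSpace 𝕜 H]

theorem norm_apply_le (T : ContractiveC0Semigroup 𝕜 M H) (t : M) (x : H) :
    ‖T.toFun t x‖ ≤ ‖x‖ := by
  simpa using (T.toFun t).le_of_opNorm_le (T.contractive t) x

/-- The family of all matrix coefficients of a contractive semigroup. -/
def coefficientFamily (T : ContractiveC0Semigroup 𝕜 M H) : CoefficientFamily 𝕜 M H where
  val p := ⟨fun t => inner 𝕜 (T.toFun t p.1) p.2,
    (T.strongly_continuous p.1).inner continuous_const⟩
  property :=
    { add_left := fun x y z t => by simp [inner_add_left]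
      smul_left := fun c x z t => by simp [inner_smul_left]
      add_right := fun x y z t => by simp [inner_add_right]
      smul_right := fun c x z t => by simp [inner_smul_right]
      bound := fun x y t => (norm_inner_le_norm _ _).trans
        (mul_le_mul_of_nonneg_right (T.norm_apply_le t x) (norm_nonneg y))
      map_zero := fun x y => by simp [T.map_zero] }

theorem isEmbedding_coefficientFamily :
    Topology.IsEmbedding (coefficientFamily : ContractiveC0Semigroup 𝕜 M H → _) := by
  constructor
  · have h1 : Topology.IsInducing (coeff : ContractiveC0Semigroup 𝕜 M H → _) := ⟨rfl⟩
    have h2 : Topology.IsInducing (Pi.map fun _ : H × H =>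
        (ContinuousMap.toUniformOnFunIsCompact : C(M, 𝕜) → _)) :=
      .piMap fun _ => ContinuousMap.isUniformEmbedding_toUniformOnFunIsCompact.isInducing
    exact (Topology.IsInducing.subtypeVal.of_comp_iff).1 (h2.of_comp_iff.1 h1)
  · intro S T h
    have h' : S.toFun = T.toFun := by
      funext t
      refine ContinuousLinearMap.ext fun x => ext_inner_right 𝕜 fun y => ?_
      exact DFunLike.congr_fun (congr_fun (congr_arg Subtype.val h) (x, y)) t
    cases S
    cases T
    congr

theorem range_coefficientFamily [ContinuousAdd M] [SigmaCompactSpace M] [CompleteSpace H]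
    {d : M → M → M} (hd : IsTruncatedDifference d) {ι : Type*} (b : HilbertBasis ι 𝕜 H)
    {u : ℕ → H} (hu : DenseRange u) :
    range (coefficientFamily : ContractiveC0Semigroup 𝕜 M H → _) =
      {F : CoefficientFamily 𝕜 M H | ∀ (m n k j : ℕ) (a : Finset ι),
      ∃ a' ≥ a, MapsTo (F.defect b (u m) (u n) a')
        (compactCovering M j ×ˢ compactCovering M j) (Metric.ball 0 (1 / (k + 1)))} := by
  ext F
  constructor
  · rintro ⟨T, rfl⟩ m n k j a
    -- Strong continuity makes this orbit piece norm compact, so the basis expansion converges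
    -- uniformly on it.
    have hK : IsCompact ((fun t => T.toFun t (u m)) '' compactCovering M j) :=
      (isCompact_compactCovering M j).image (T.strongly_continuous _)
    obtain ⟨δ, hδ, hδk⟩ := exists_pos_mul_lt (show (0 : ℝ) < 1 / (k + 1) by positivity) ‖u n‖
    obtain ⟨a', ha', ha⟩ :=
      ((b.eventually_forall_norm_sum_sub_lt hK hδ).and (eventually_ge_atTop a)).exists
    refine ⟨a', ha, fun p hp => ?_⟩
    rw [CoefficientFamily.defect_apply (T := T.toFun) b (u m) (u n) a' _ (fun _ _ _ => rfl) p,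
      mem_ball_zero_iff, T.map_add, ContinuousLinearMap.comp_apply, ← map_sub]
    refine ((norm_inner_le_norm _ _).trans (mul_le_mul_of_nonneg_right
      ((T.norm_apply_le _ _).trans (ha' _ (mem_image_of_mem _ hp.2)).le)
      (norm_nonneg _))).trans_lt ?_
    rwa [mul_comm]
  · intro hF
    choose T hT1 hT using F.exists_operator
    have map_zero : T 0 = ContinuousLinearMap.id 𝕜 H :=
      ContinuousLinearMap.ext fun x => ext_inner_right 𝕜 fun y => by
        rw [hT, F.2.map_zero]
        rfl
    have key : ∀ s t m n, inner 𝕜 (T s (T t (u m))) (u n) = inner 𝕜 (T (s + t) (u m)) (u n) := by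
      intro s t m n
      obtain ⟨i, hi⟩ := exists_mem_compactCovering s
      obtain ⟨i', hi'⟩ := exists_mem_compactCovering t
      have hs := compactCovering_subset M (le_max_left i i') hi
      have ht := compactCovering_subset M (le_max_right i i') hi'
      have hsum : HasSum (fun i => inner 𝕜 (b i) (T t (u m)) • b i) (T t (u m)) := by
        simpa only [b.repr_apply_apply] using b.hasSum_repr (T t (u m))
      have hlim : Tendsto (fun a : Finset ι => F.defect b (u m) (u n) a (s, t)) atTop
          (𝓝 (inner 𝕜 (T s (T t (u m)) - T (s + t) (u m)) (u n))) := by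
        simp only [CoefficientFamily.defect_apply b (u m) (u n) _ F hT]
        have hc : Continuous fun x : H => inner 𝕜 (T s x - T (s + t) (u m)) (u n) :=
          (((T s).continuous).sub continuous_const).inner continuous_const
        exact (hc.tendsto _).comp hsum
      rw [← sub_eq_zero, ← inner_sub_left, ← norm_eq_zero]
      refine le_antisymm (le_of_forall_pos_le_add fun ε hε => ?_) (norm_nonneg _)
      rw [zero_add]
      obtain ⟨k, hk⟩ := exists_nat_one_div_lt hε
      -- The condition makes the defect small only for cofinally many `a`. This suffices because at
      -- fixed `(s, t)` its limit exists.
      refine le_of_tendsto_of_frequently hlim.norm (frequently_atTop.2 fun a => ?_)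
      obtain ⟨a', ha, hmap⟩ := hF m n k (max i i') a
      exact ⟨a', ha, ((mem_ball_zero_iff.1 (hmap ⟨hs, ht⟩)).trans hk).le⟩
    have map_add : ∀ s t, T (s + t) = (T s).comp (T t) := by
      intro s t
      refine ContinuousLinearMap.ext fun x => ext_inner_right 𝕜 fun y => ?_
      refine hu.induction_on (p := fun x => inner 𝕜 (T (s + t) x) y =
        inner 𝕜 ((T s).comp (T t) x) y) x (isClosed_eq (by fun_prop) (by fun_prop)) fun m => ?_
      refine hu.induction_on (p := fun y => inner 𝕜 (T (s + t) (u m)) y =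
        inner 𝕜 ((T s).comp (T t) (u m)) y) y (isClosed_eq (by fun_prop) (by fun_prop)) fun n => ?_
      exact (key s t m n).symm
    refine ⟨⟨T, map_zero, map_add, hT1, fun ξ => ?_⟩, ?_⟩
    · refine continuous_orbit_of_continuous_inner hd map_zero map_add hT1 ?_
      simp only [hT]
      exact (F.1 (ξ, ξ)).continuous
    · exact Subtype.ext (funext fun p => ContinuousMap.ext fun t => hT t p.1 p.2)

/-- The contractive `C₀`-semigroups over a separable Hilbert space, on a locally compact second
countable monoid with truncated differences, form a Polish space. -/
theorem polishSpace [ContinuousAdd M] [LocallyCompactSpace M] [SecondCountableTopology M]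
    [CompleteSpace H] [SeparableSpace H] {d : M → M → M} (hd : IsTruncatedDifference d) :
    PolishSpace (ContractiveC0Semigroup 𝕜 M H) := by
  obtain ⟨w, b, -⟩ := exists_hilbertBasis 𝕜 H
  have : Countable w := b.orthonormal.countable
  refine isEmbedding_coefficientFamily.polishSpace_of_isGδ_range ?_
  rw [range_coefficientFamily hd b (denseRange_denseSeq H)]
  exact CoefficientFamily.isGδ_setOf_exists_defect_lt b (denseSeq H)

end ContractiveC0Semigroup

/-! ### Truncated differences on `ℝ≥0` and its powers -/

theorem NNReal.isTruncatedDifference_sub :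
    IsTruncatedDifference fun t u : ℝ≥0 => t - u where
  continuous := continuous_fst.sub continuous_snd
  self := tsub_self
  exists_add t u := ⟨min t u, by rw [add_comm, tsub_add_min],
    by rw [add_comm, min_comm, tsub_add_min]⟩

theorem IsTruncatedDifference.pi {ι M : Type*} [AddMonoid M] [TopologicalSpace M]
    {d : M → M → M} (hd : IsTruncatedDifference d) :
    IsTruncatedDifference fun (t u : ι → M) i => d (t i) (u i) where
  continuous := continuous_pi fun i => hd.continuous.comp
    (f := fun p : (ι → M) × (ι → M) => (p.1 i, p.2 i)) (by fun_prop)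
  self t := funext fun i => hd.self (t i)
  exists_add t u := by
    choose m hm using fun i => hd.exists_add (t i) (u i)
    exact ⟨m, funext fun i => (hm i).1, funext fun i => (hm i).2⟩

theorem mainTheorem2 {𝕜 H : Type*} [RCLike 𝕜] [NormedAddCommGroup H] [InnerProductSpace 𝕜 H]
    [CompleteSpace H] [TopologicalSpace.SeparableSpace H] :
    PolishSpace (ContractiveC0Semigroup 𝕜 ℝ≥0 H) ∧
      ∀ d : ℕ, PolishSpace (ContractiveC0Semigroup 𝕜 (Fin d → ℝ≥0) H) :=
  ⟨ContractiveC0Semigroup.polishSpace NNReal.isTruncatedDifference_sub,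
    fun _ => ContractiveC0Semigroup.polishSpace NNReal.isTruncatedDifference_sub.pi⟩
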